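/- Let $\widetilde\Gamma$ be a simply-laced extended Dynkin graph, i.e. a graph of type $\tilde A_n$ ($n\ge 2$), $\tilde D_n$ ($n\ge 4$), $\tilde E_6$, $\tilde E_7$ or $\tilde E_8$, with vertex set $\widetilde I$. Let $i_0\in\widetilde I$ be an extending vertex, i.e. a vertex whose removal leaves the Dynkin graph $\Gamma$ of the corresponding type. Let $\delta\in\mathbb Z_{>0}^{\widetilde I}$ be the unique vector with $\delta_{i_0}=1$ and $\langle\delta,u\rangle=0$ for all $u\in\mathbb R^{\widetilde I}$, where $\langle\,,\rangle$ is the Cartan form ($\langle\alpha_i,\alpha_i\rangle=2$, $\langle\alpha_i,\alpha_j\rangle=-1$ if $i,j$ are adjacent, and $0$ otherwise). In the numbers game with a cutoff on a finite graph with vertex set $I$, the configurations are the vectors $v\in\mathbb R^I$. A configuration is *forbidden* if $v_i<-1$ for some $i$. If $v$ is not forbidden and $v_i<0$, one may fire the vertex $i$: $v_i$ is replaced by $-v_i$, and $v_i$ is added to $v_j$ for every $j$ adjacent to $i$. The game terminates when it reaches a forbidden configuration or one with all amplitudes nonnegative. The configuration $v$ is *winning* if a configuration with all amplitudes nonnegative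 can be reached from it (in zero or more moves). It is *looping* if, starting from $v$, the game can continue indefinitely and only finitely many configurations can be reached. Let $v\in\mathbb R^{\widetilde I}$ be nonzero with $\delta\cdot v=0$. Then $v$ is looping on $\widetilde\Gamma$ if and only if both restrictions $v|_{\Gamma}$ and $-v|_{\Gamma}$ to the graph $\Gamma=\widetilde\Gamma\setminus\{i_0\}$ are winning. Moreover, if $v$ is looping, then the game that starts at $v$ cannot terminate, however it is played. -/

import Mathlib

namespace NumbersGame

/-! ### Simply-laced Dynkin and extended Dynkin graphs -/

/-- The types `Aₙ`, `Dₙ`, `E₆`, `E₇`, `E₈` whose extended Dynkin graph is a graph without loops and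
multiple edges. Thus `A₁` is absent: its extended graph has a double edge. -/
inductive SimplyLacedType
  | A (n : ℕ) (hn : 2 ≤ n)
  | D (n : ℕ) (hn : 4 ≤ n)
  | E6
  | E7
  | E8

namespace SimplyLacedType

/-- The number of vertices of the Dynkin graph; the extended Dynkin graph has one more. -/
def rank : SimplyLacedType → ℕ
  | A n _ => n
  | D n _ => n
  | E6 => 6
  | E7 => 7
  | E8 => 8

/-- `Dₙ`: the path `0 - 1 - ⋯ - (n-2)`, and `n-1` attached to `n-3`. -/
def graphD (n : ℕ) : SimpleGraph (Fin n) :=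
  SimpleGraph.fromRel fun i j =>
    (i.val + 1 = j.val ∧ j.val + 1 < n) ∨ (i.val + 3 = n ∧ j.val + 1 = n)

/-- `Eₙ` (for `n = 6, 7, 8`): the path `0 - 1 - ⋯ - (n-2)`, and `n-1` attached to `2`. -/
def graphE (n : ℕ) : SimpleGraph (Fin n) :=
  SimpleGraph.fromRel fun i j =>
    (i.val + 1 = j.val ∧ j.val + 1 < n) ∨ (i.val = 2 ∧ j.val + 1 = n)

/-- `D̃ₙ` on the vertices `0, …, n`: the path `1 - 2 - ⋯ - (n-1)`, with `0` attached to `2` and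
`n` attached to `n-2`. -/
def extGraphD (n : ℕ) : SimpleGraph (Fin (n + 1)) :=
  SimpleGraph.fromRel fun i j =>
    (1 ≤ i.val ∧ i.val + 1 = j.val ∧ j.val < n) ∨ (i.val = 0 ∧ j.val = 2) ∨
      (i.val + 2 = n ∧ j.val = n)

/-- `Ẽ₆`: the path `0 - 1 - 2 - 3 - 4`, and the path `2 - 5 - 6`. -/
def extGraphE6 : SimpleGraph (Fin 7) :=
  SimpleGraph.fromRel fun i j =>
    (i.val + 1 = j.val ∧ j.val ≤ 4) ∨ (i.val = 2 ∧ j.val = 5) ∨ (i.val = 5 ∧ j.val = 6)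

/-- `Ẽ₇`: the path `0 - 1 - ⋯ - 6`, and `7` attached to `3`. -/
def extGraphE7 : SimpleGraph (Fin 8) :=
  SimpleGraph.fromRel fun i j => (i.val + 1 = j.val ∧ j.val ≤ 6) ∨ (i.val = 3 ∧ j.val = 7)

/-- `Ẽ₈`: the path `0 - 1 - ⋯ - 7`, and `8` attached to `2`. -/
def extGraphE8 : SimpleGraph (Fin 9) :=
  SimpleGraph.fromRel fun i j => (i.val + 1 = j.val ∧ j.val ≤ 7) ∨ (i.val = 2 ∧ j.val = 8)

/-- The Dynkin graph of a given type. -/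
def dynkinGraph : (X : SimplyLacedType) → SimpleGraph (Fin X.rank)
  | A n _ => SimpleGraph.pathGraph n
  | D n _ => graphD n
  | E6 => graphE 6
  | E7 => graphE 7
  | E8 => graphE 8

/-- The extended Dynkin graph of a given type. -/
def extDynkinGraph : (X : SimplyLacedType) → SimpleGraph (Fin (X.rank + 1))
  | A n _ => SimpleGraph.cycleGraph (n + 1)
  | D n _ => extGraphD n
  | E6 => extGraphE6
  | E7 => extGraphE7
  | E8 => extGraphE8

end SimplyLacedType

variable {I : Type*}

/-- `G` is an extended Dynkin graph of type `X`. -/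
def IsExtendedDynkin (X : SimplyLacedType) (G : SimpleGraph I) : Prop :=
  Nonempty (G ≃g X.extDynkinGraph)

/-- The graph obtained from `G` by removing the vertex `i₀`. -/
abbrev removeVertex (G : SimpleGraph I) (i₀ : I) : SimpleGraph {j : I // j ≠ i₀} :=
  G.comap Subtype.val

/-- `i₀` is an extending vertex of the extended Dynkin graph `G` of type `X`: removing it leaves
the Dynkin graph of type `X`. -/
def IsExtendingVertex (X : SimplyLacedType) (G : SimpleGraph I) (i₀ : I) : Prop :=
  Nonempty (removeVertex G i₀ ≃g X.dynkinGraph)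

open Classical in
/-- The Cartan form of the graph `G` on `ℝ^I`. -/
noncomputable def cartanForm [Fintype I] (G : SimpleGraph I) (x y : I → ℝ) : ℝ :=
  ∑ i, ∑ j, x i * (if i = j then 2 else if G.Adj i j then -1 else 0) * y j

/-- The characterization of the vector `δ ∈ ℤ_{>0}^I`: it is in the kernel of the Cartan
form and its coordinate at the extending vertex `i₀` is `1`. -/
structure IsDelta [Fintype I] (G : SimpleGraph I) (i₀ : I) (δ : I → ℤ) : Prop where
  pos : ∀ i, 0 < δ i
  kernel : ∀ u : I → ℝ, cartanForm G (fun i => (δ i : ℝ)) u = 0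
  extending : δ i₀ = 1

/-! ### The numbers game with a cutoff -/

open Classical in
/-- Firing the vertex `i`. -/
noncomputable def fire (G : SimpleGraph I) (i : I) (v : I → ℝ) : I → ℝ := fun j =>
  if j = i then -v i else if G.Adj i j then v j + v i else v j

/-- A configuration is forbidden if some amplitude is less than `-1`. -/
def Forbidden (v : I → ℝ) : Prop := ∃ i, v i < -1

/-- A move of the game with a cutoff: a vertex of negative amplitude is fired in a configuration
that is not forbidden. -/
def Move (G : SimpleGraph I) (v w : I → ℝ) : Prop :=
  ¬ Forbidden v ∧ ∃ i, v i < 0 ∧ w = fire G i v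

/-- `w` can be reached from `v` by playing the game with a cutoff (zero moves are allowed). -/
def Reaches (G : SimpleGraph I) (v w : I → ℝ) : Prop := Relation.ReflTransGen (Move G) v w

/-- `v` is winning: a configuration with all amplitudes nonnegative can be reached. -/
def Winning (G : SimpleGraph I) (v : I → ℝ) : Prop := ∃ w, Reaches G v w ∧ ∀ i, 0 ≤ w i

/-- The game with a cutoff has terminated at `v`: all amplitudes are nonnegative, or `v` is
forbidden. -/
def Terminated (v : I → ℝ) : Prop := (∀ i, 0 ≤ v i) ∨ Forbidden v

/-- The game that starts at `v` cannot terminate, however it is played. -/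
def CannotTerminate (G : SimpleGraph I) (v : I → ℝ) : Prop := ∀ w, Reaches G v w → ¬ Terminated w

/-- `v` is looping: the game that starts at `v` can go on forever, and only finitely many
configurations are reached. -/
def Looping (G : SimpleGraph I) (v : I → ℝ) : Prop :=
  (∃ u : ℕ → I → ℝ, u 0 = v ∧ ∀ n, Move G (u n) (u (n + 1))) ∧ {w | Reaches G v w}.Finite

end NumbersGame

namespace NumbersGame

/-! Firing a vertex is adjoint to the simple reflection (`pairing_fire`), so the game is governed by
the values of `v` on the roots, taken here as the integral vectors of norm 2. Call `v` `Bounded` if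
it is at least -1 on every positive root.

On `Γ` there are finitely many positive roots, and winning is equivalent to `Bounded`
(`winning_iff_bounded`): a simple reflection permutes the positive roots other than its own simple
root, so each firing lowers the number of positive roots on which `v` is negative.

On the extended graph, translation by `δ` preserves the roots and, as `δ · v = 0`, also the values
of `v`. Every root is thus congruent to a root of `Γ`, and each root of `Γ` and its negative are
congruent to positive roots. Hence `v` is `Bounded` if and only if both restrictions are
(`IsNull.bounded_iff_winning`).

It remains to see that looping means `Bounded`. Boundedness survives firing and excludes forbidden
configurations; the only nonnegative configuration orthogonal to `δ` is 0, which firing never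
produces; and the amplitudes stay in a finite set of root values. The converse is
`IsNull.bounded_of_play`. The classification of graphs enters through connectedness. -/

open Matrix

/-! ### Roots and reflections -/

section Roots

variable {I : Type*}

open Classical in
/-- The Cartan matrix of a graph. -/
noncomputable def cartan (G : SimpleGraph I) : Matrix I I ℤ := fun i j =>
  if i = j then 2 else if G.Adj i j then -1 else 0

theorem cartan_self (G : SimpleGraph I) (i : I) : cartan G i i = 2 := by simp [cartan]

theorem cartan_symm (G : SimpleGraph I) (i j : I) : cartan G i j = cartan G j i := by
  by_cases h : i = j
  · rw [h]
  · by_cases h' : G.Adj i j <;> simp [cartan, h, Ne.symm h, h', G.adj_comm j i]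

theorem cartan_transpose (G : SimpleGraph I) : (cartan G)ᵀ = cartan G := by
  ext i j
  exact cartan_symm G j i

theorem cartan_nonpos (G : SimpleGraph I) {i j : I} (h : i ≠ j) : cartan G i j ≤ 0 := by
  simp only [cartan, h, if_false]
  split_ifs <;> simp

theorem cartan_adj (G : SimpleGraph I) {i j : I} (h : G.Adj i j) : cartan G i j = -1 := by
  simp [cartan, h, h.ne]

theorem fire_apply (G : SimpleGraph I) (i : I) (v : I → ℝ) (j : I) :
    fire G i v j = v j - cartan G i j * v i := by
  unfold fire cartan
  by_cases h : j = i
  · subst h; simp; ring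
  · by_cases h' : G.Adj i j <;> simp [h, h', Ne.symm h]

theorem fire_self (G : SimpleGraph I) (i : I) (v : I → ℝ) : fire G i v i = -v i := by
  simp [fire]

theorem fire_ne_zero {v : I → ℝ} {i : I} (hi : v i < 0) : fire G i v ≠ 0 := fun h => by
  have := congrFun h i
  rw [fire_self, Pi.zero_apply] at this
  linarith

variable [Fintype I]

/-- The quadratic form of the Cartan matrix. -/
noncomputable def quad (G : SimpleGraph I) (a : I → ℤ) : ℤ := a ⬝ᵥ (cartan G *ᵥ a)

/-- The (real) roots of a graph: the integral vectors of norm two. -/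
def IsRoot (G : SimpleGraph I) (a : I → ℤ) : Prop := quad G a = 2

/-- Every root is positive or negative. -/
def SignedRoots (G : SimpleGraph I) : Prop := ∀ a, IsRoot G a → 0 ≤ a ∨ a ≤ 0

open Classical in
/-- The reflection at the simple root of the vertex `i`. -/
noncomputable def refl (G : SimpleGraph I) (i : I) (a : I → ℤ) : I → ℤ :=
  a - Pi.single i ((cartan G *ᵥ a) i)

/-- The value of a configuration on an integral vector. -/
noncomputable def pairing (a : I → ℤ) (v : I → ℝ) : ℝ := ∑ i, (a i : ℝ) * v i

theorem dot_cartan_comm (G : SimpleGraph I) (a b : I → ℤ) :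
    a ⬝ᵥ (cartan G *ᵥ b) = b ⬝ᵥ (cartan G *ᵥ a) := by
  rw [dotProduct_mulVec, ← mulVec_transpose, cartan_transpose, dotProduct_comm]

theorem quad_sub (G : SimpleGraph I) (a b : I → ℤ) :
    quad G (a - b) = quad G a + quad G b - 2 * (a ⬝ᵥ (cartan G *ᵥ b)) := by
  unfold quad
  rw [mulVec_sub, sub_dotProduct, dotProduct_sub, dotProduct_sub, dot_cartan_comm G b a]
  ring

theorem quad_neg (G : SimpleGraph I) (a : I → ℤ) : quad G (-a) = quad G a := by
  simp [quad, mulVec_neg]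

open Classical in
theorem dot_cartan_single (G : SimpleGraph I) (a : I → ℤ) (i : I) (k : ℤ) :
    a ⬝ᵥ (cartan G *ᵥ Pi.single i k) = k * (cartan G *ᵥ a) i := by
  rw [dot_cartan_comm, single_dotProduct]

open Classical in
theorem cartan_mulVec_single (G : SimpleGraph I) (i j : I) (k : ℤ) :
    (cartan G *ᵥ Pi.single i k) j = cartan G j i * k := by
  simp [mulVec, dotProduct_single]

open Classical in
theorem quad_single (G : SimpleGraph I) (i : I) (k : ℤ) :
    quad G (Pi.single i k) = 2 * k ^ 2 := by
  unfold quad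
  rw [single_dotProduct, cartan_mulVec_single, cartan_self]
  ring

open Classical in
theorem isRoot_single (G : SimpleGraph I) (i : I) : IsRoot G (Pi.single i 1) := by
  simp [IsRoot, quad_single]

theorem quad_refl (G : SimpleGraph I) (i : I) (a : I → ℤ) : quad G (refl G i a) = quad G a := by
  unfold refl
  rw [quad_sub, quad_single, dot_cartan_single]
  ring

theorem IsRoot.refl {G : SimpleGraph I} {a : I → ℤ} (h : IsRoot G a) (i : I) :
    IsRoot G (refl G i a) := (quad_refl G i a).trans h

theorem refl_refl (G : SimpleGraph I) (i : I) (a : I → ℤ) : refl G i (refl G i a) = a := by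
  classical
  have h : (cartan G *ᵥ refl G i a) i = -(cartan G *ᵥ a) i := by
    unfold refl
    rw [mulVec_sub, Pi.sub_apply, cartan_mulVec_single, cartan_self]
    ring
  have h' : refl G i (refl G i a) = refl G i a - Pi.single i ((cartan G *ᵥ refl G i a) i) := by
    unfold refl; congr!
  rw [h', h]
  ext j
  by_cases hj : j = i
  · subst hj; simp [refl]
  · simp [refl, hj]

theorem refl_apply_of_ne (G : SimpleGraph I) {i j : I} (h : j ≠ i) (a : I → ℤ) :
    refl G i a j = a j := by simp [refl, h]

open Classical in
theorem refl_single_self (G : SimpleGraph I) (i : I) :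
    refl G i (Pi.single i 1) = -Pi.single i 1 := by
  ext j
  unfold refl
  rw [cartan_mulVec_single, cartan_self]
  by_cases hj : j = i
  · subst hj; simp
  · simp [hj]

/-- The reflection alters only coordinate `i`. If it makes a positive root negative, that root is
supported at `i`, and norm 2 forces the coefficient 1. -/
theorem IsRoot.eq_single_or_refl_nonneg {G : SimpleGraph I} (hs : SignedRoots G) {a : I → ℤ}
    (ha : IsRoot G a) (h0 : 0 ≤ a) (i : I) [DecidableEq I] :
    a = Pi.single i 1 ∨ 0 ≤ NumbersGame.refl G i a := by
  rcases hs _ (ha.refl i) with h | h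
  · exact Or.inr h
  left
  have h1 : a = Pi.single i (a i) := by
    ext j
    by_cases hj : j = i
    · subst hj; simp
    · have h2 := h j
      rw [refl_apply_of_ne G hj] at h2
      simpa [hj] using le_antisymm h2 (h0 j)
  have h2 : quad G a = 2 * (a i) ^ 2 := by
    conv_lhs => rw [h1]
    convert quad_single G i (a i)
  have h3 : (a i) ^ 2 = 1 := by
    have := ha
    unfold IsRoot at this
    omega
  have h4 : a i = 1 := by
    have := h0 i
    simp only [Pi.zero_apply] at this
    nlinarith
  rw [h1, h4]

theorem pairing_refl (G : SimpleGraph I) (i : I) (a : I → ℤ) (v : I → ℝ) :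
    pairing (refl G i a) v = pairing a v - (cartan G *ᵥ a) i * v i := by
  classical
  unfold pairing refl
  simp only [Pi.sub_apply, Int.cast_sub, sub_mul, Finset.sum_sub_distrib]
  congr 1
  rw [Finset.sum_eq_single i] <;> simp +contextual

theorem pairing_fire (G : SimpleGraph I) (i : I) (a : I → ℤ) (v : I → ℝ) :
    pairing a (fire G i v) = pairing (refl G i a) v := by
  rw [pairing_refl]
  unfold pairing
  simp only [fire_apply, mul_sub, Finset.sum_sub_distrib]
  congr 1
  simp only [mulVec, dotProduct, Int.cast_sum, Int.cast_mul, Finset.sum_mul]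
  exact Finset.sum_congr rfl fun j _ => by ring

theorem pairing_refl_fire (G : SimpleGraph I) (i : I) (a : I → ℤ) (v : I → ℝ) :
    pairing (refl G i a) (fire G i v) = pairing a v := by
  rw [pairing_fire, refl_refl]

open Classical in
theorem pairing_single (i : I) (v : I → ℝ) : pairing (Pi.single i 1) v = v i := by
  unfold pairing
  rw [Finset.sum_eq_single i] <;> simp +contextual

/-! ### The game on a graph with finitely many positive roots -/

/-- All values on positive roots are at least `-1`. -/
def Bounded (G : SimpleGraph I) (v : I → ℝ) : Prop :=
  ∀ a, IsRoot G a → 0 ≤ a → -1 ≤ pairing a v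

theorem Bounded.not_forbidden {G : SimpleGraph I} {v : I → ℝ} (h : Bounded G v) :
    ¬ Forbidden v := by
  classical
  rintro ⟨i, hi⟩
  have := h _ (isRoot_single G i) (Pi.single_nonneg.2 zero_le_one)
  rw [pairing_single] at this
  linarith

theorem Bounded.fire {G : SimpleGraph I} (hs : SignedRoots G) {v : I → ℝ} (h : Bounded G v)
    {i : I} (hi : v i < 0) : Bounded G (fire G i v) := by
  classical
  intro a ha h0
  rcases ha.eq_single_or_refl_nonneg hs h0 i with rfl | h1
  · rw [pairing_single, fire_self]; linarith
  · rw [pairing_fire]; exact h _ (ha.refl i) h1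

/-- Boundedness can be pulled back along a legal move: the simple root of `i` is the only positive
root not covered by reflection, and there the cutoff gives the bound. -/
theorem bounded_of_fire {G : SimpleGraph I} (hs : SignedRoots G) {v : I → ℝ} {i : I}
    (hi : -1 ≤ v i) (h : Bounded G (fire G i v)) : Bounded G v := by
  classical
  intro a ha h0
  rcases ha.eq_single_or_refl_nonneg hs h0 i with rfl | h1
  · rwa [pairing_single]
  · rw [← pairing_refl_fire G i]; exact h _ (ha.refl i) h1

/-- The positive roots on which `v` is negative. -/
def negRoots (G : SimpleGraph I) (v : I → ℝ) : Set (I → ℤ) :=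
  {a | IsRoot G a ∧ 0 ≤ a ∧ pairing a v < 0}

/-- The reflection at `i` injects the negative roots after firing into those before, and misses the
simple root of `i`. -/
theorem ncard_negRoots_fire_lt {G : SimpleGraph I} (hs : SignedRoots G)
    (hf : {a | IsRoot G a ∧ 0 ≤ a}.Finite) {v : I → ℝ} {i : I} (hi : v i < 0) :
    (negRoots G (fire G i v)).ncard < (negRoots G v).ncard := by
  classical
  have hfin : (negRoots G v).Finite := hf.subset fun a h => ⟨h.1, h.2.1⟩
  have hmem : Pi.single i 1 ∈ negRoots G v :=
    ⟨isRoot_single G i, Pi.single_nonneg.2 zero_le_one, by rwa [pairing_single]⟩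
  refine lt_of_le_of_lt ?_ (Set.ncard_sdiff_singleton_lt_of_mem hmem hfin)
  refine Set.ncard_le_ncard_of_injOn (refl G i) ?_ ?_ (hfin.subset Set.sdiff_subset)
  · rintro a ⟨ha, h0, hneg⟩
    have h1 : 0 ≤ refl G i a := by
      rcases ha.eq_single_or_refl_nonneg hs h0 i with rfl | h1
      · rw [pairing_single, fire_self] at hneg; linarith
      · exact h1
    refine ⟨⟨ha.refl i, h1, by rwa [← pairing_fire]⟩, fun h => ?_⟩
    rw [Set.mem_singleton_iff] at h
    have h2 : a = -Pi.single i 1 := by rw [← refl_refl G i a, h, refl_single_self]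
    have h3 := h0 i
    simp [h2] at h3
  · intro a _ b _ h
    rw [← refl_refl G i a, h, refl_refl]

theorem winning_iff_bounded {G : SimpleGraph I} (hs : SignedRoots G)
    (hf : {a | IsRoot G a ∧ 0 ≤ a}.Finite) (v : I → ℝ) : Winning G v ↔ Bounded G v := by
  constructor
  · rintro ⟨w, hw, h0⟩
    induction hw using Relation.ReflTransGen.head_induction_on with
    | refl =>
      intro a _ ha
      have : 0 ≤ pairing a w :=
        Finset.sum_nonneg fun i _ => mul_nonneg (Int.cast_nonneg (ha i)) (h0 i)
      linarith
    | head h _ ih =>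
      obtain ⟨hnf, i, -, rfl⟩ := h
      exact bounded_of_fire hs (not_lt.1 fun hi => hnf ⟨i, hi⟩) ih
  · intro h
    induction hn : (negRoots G v).ncard using Nat.strong_induction_on generalizing v with
    | _ n ih =>
      by_cases h0 : ∀ i, 0 ≤ v i
      · exact ⟨v, .refl, h0⟩
      push Not at h0
      obtain ⟨i, hi⟩ := h0
      obtain ⟨w, hw, hw0⟩ := ih _ (hn ▸ ncard_negRoots_fire_lt hs hf hi) _ (h.fire hs hi) rfl
      exact ⟨w, .head ⟨h.not_forbidden, i, hi, rfl⟩ hw, hw0⟩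

/-! ### The parity of the quadratic form -/

/-- Modulo 2 the terms at `(i, j)` and `(j, i)` cancel, and the diagonal terms are even. -/
theorem even_quad (G : SimpleGraph I) (a : I → ℤ) : Even (quad G a) := by
  classical
  rw [← ZMod.intCast_eq_zero_iff_even]
  have h : quad G a = ∑ x : I × I, a x.1 * (cartan G x.1 x.2 * a x.2) := by
    simp only [quad, dotProduct, mulVec, Finset.mul_sum, Fintype.sum_prod_type]
  rw [h, Int.cast_sum]
  refine Finset.sum_involution (fun x _ => x.swap) ?_ ?_ (fun _ _ => Finset.mem_univ _)
    (fun _ _ => Prod.swap_swap _)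
  · rintro ⟨i, j⟩ -
    simp only [Prod.swap]
    rw [cartan_symm G j i, show a j * (cartan G i j * a i) = a i * (cartan G i j * a j) by ring]
    exact CharTwo.add_self_eq_zero _
  · rintro ⟨i, j⟩ - hne heq
    apply hne
    simp only [Prod.swap, Prod.mk.injEq] at heq
    obtain ⟨rfl, -⟩ := heq
    rw [cartan_self, Int.cast_mul, Int.cast_mul, show ((2 : ℤ) : ZMod 2) = 0 from rfl]
    ring

end Roots

/-! ### Connected graphs with a positive vector in the kernel of the Cartan matrix -/

/-- `d` is a positive vector in the kernel of the Cartan matrix. -/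
structure IsNull {I : Type*} [Fintype I] (G : SimpleGraph I) (d : I → ℤ) : Prop where
  pos : ∀ i, 0 < d i
  kernel : cartan G *ᵥ d = 0

section Affine

variable {I : Type*} [Fintype I] {G : SimpleGraph I} {d : I → ℤ}

theorem IsDelta.isNull {i₀ : I} (h : IsDelta G i₀ d) : IsNull G d := by
  classical
  refine ⟨h.pos, ?_⟩
  ext j
  have hk := h.kernel (Pi.single j 1)
  unfold cartanForm at hk
  have h1 : ((∑ i, d i * cartan G i j : ℤ) : ℝ) = 0 := by
    rw [← hk, Int.cast_sum]
    refine Finset.sum_congr rfl fun i _ => ?_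
    rw [Finset.sum_eq_single j]
    · simp [cartan]
    · intro k _ hkj
      simp [hkj]
    · simp
  have h2 : ∑ i, d i * cartan G i j = 0 := by exact_mod_cast h1
  rw [Pi.zero_apply, ← h2]
  simp only [mulVec, dotProduct]
  exact Finset.sum_congr rfl fun i _ => by rw [cartan_symm, mul_comm]

/-- Sum-of-squares form, which shows semidefiniteness with radical spanned by `d` on a connected
graph. After expansion, the pure squares vanish because `d` kills the rows and columns of the Cartan
matrix. -/
theorem IsNull.two_mul_quad (h : IsNull G d) (a : I → ℤ) :
    2 * (quad G a : ℝ) = ∑ i, ∑ j, -(cartan G i j : ℝ) * (d i * d j) *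
      ((a i : ℝ) / d i - a j / d j) ^ 2 := by
  have hd : ∀ i, (d i : ℝ) ≠ 0 := fun i => by exact_mod_cast (h.pos i).ne'
  have hr : ∀ i, ∑ j, (cartan G i j : ℝ) * d j = 0 := fun i => by
    have := congrFun h.kernel i
    simp only [mulVec, dotProduct, Pi.zero_apply] at this
    exact_mod_cast this
  have hc : ∀ j, ∑ i, (cartan G i j : ℝ) * d i = 0 := fun j => by
    simp only [cartan_symm G _ j]
    exact hr j
  have hq : (quad G a : ℝ) = ∑ i, ∑ j, (a i : ℝ) * cartan G i j * a j := by
    simp only [quad, dotProduct, mulVec, Finset.mul_sum, Int.cast_sum, Int.cast_mul, mul_assoc]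
  have key : ∀ i j, -(cartan G i j : ℝ) * (d i * d j) * ((a i : ℝ) / d i - a j / d j) ^ 2 =
      2 * ((a i : ℝ) * cartan G i j * a j) - (a i : ℝ) ^ 2 / d i * (cartan G i j * d j)
        - (a j : ℝ) ^ 2 / d j * (cartan G i j * d i) := fun i j => by
    have := hd i
    have := hd j
    field_simp
    ring
  simp only [key, Finset.sum_sub_distrib, ← Finset.mul_sum, hr, mul_zero, sub_zero]
  rw [Finset.sum_comm (f := fun i j => (a j : ℝ) ^ 2 / d j * (cartan G i j * d i))]
  simp only [← Finset.mul_sum, hc, mul_zero, sub_zero, Finset.sum_const_zero, hq]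

theorem IsNull.term_nonneg (h : IsNull G d) (a : I → ℤ) (i j : I) :
    0 ≤ -(cartan G i j : ℝ) * (d i * d j) * ((a i : ℝ) / d i - a j / d j) ^ 2 := by
  by_cases hij : i = j
  · simp [hij]
  · have h1 : (cartan G i j : ℝ) ≤ 0 := by exact_mod_cast cartan_nonpos G hij
    have h2 : (0 : ℝ) < d i := by exact_mod_cast h.pos i
    have h3 : (0 : ℝ) < d j := by exact_mod_cast h.pos j
    have h4 : 0 ≤ -(cartan G i j : ℝ) := by linarith
    positivity

theorem IsNull.quad_nonneg (h : IsNull G d) (a : I → ℤ) : 0 ≤ quad G a := by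
  have h1 : (0 : ℝ) ≤ 2 * (quad G a : ℝ) := by
    rw [h.two_mul_quad]
    exact Finset.sum_nonneg fun i _ => Finset.sum_nonneg fun j _ => h.term_nonneg a i j
  have h2 : (0 : ℝ) ≤ quad G a := by linarith
  exact_mod_cast h2

theorem IsNull.sq_sub_le (h : IsNull G d) (a : I → ℤ) {i j : I} (hij : G.Adj i j) :
    ((a i : ℝ) / d i - a j / d j) ^ 2 ≤ 2 * quad G a := by
  have h1 : -(cartan G i j : ℝ) * (d i * d j) * ((a i : ℝ) / d i - a j / d j) ^ 2
      ≤ 2 * quad G a := by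
    rw [h.two_mul_quad]
    exact (Finset.single_le_sum (fun j _ => h.term_nonneg a i j) (Finset.mem_univ j)).trans
      (Finset.single_le_sum (f := fun i => ∑ j, -(cartan G i j : ℝ) * (d i * d j) *
        ((a i : ℝ) / d i - a j / d j) ^ 2)
        (fun i _ => Finset.sum_nonneg fun j _ => h.term_nonneg a i j) (Finset.mem_univ i))
  rw [cartan_adj G hij] at h1
  refine le_trans ?_ h1
  have h2 : (1 : ℝ) ≤ d i := by exact_mod_cast h.pos i
  have h3 : (1 : ℝ) ≤ d j := by exact_mod_cast h.pos j
  have h4 : (1 : ℝ) ≤ -((-1 : ℤ) : ℝ) * (d i * d j) := by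
    push_cast
    nlinarith
  exact le_mul_of_one_le_left (sq_nonneg _) h4

theorem IsNull.eq_zero_of_quad_eq_zero (h : IsNull G d) (hG : G.Preconnected) {a : I → ℤ}
    (ha : quad G a = 0) {k : I} (hk : a k = 0) : a = 0 := by
  ext i
  obtain ⟨p⟩ := hG i k
  have hc : (a i : ℝ) / d i = a k / d k := by
    induction p with
    | nil => rfl
    | cons hadj _ ih =>
      rw [← ih hk]
      have := h.sq_sub_le a hadj
      rw [ha] at this
      rw [Int.cast_zero, mul_zero] at this
      exact sub_eq_zero.1 (sq_eq_zero_iff.1 (le_antisymm this (sq_nonneg _)))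
  rw [hk, Int.cast_zero, zero_div, div_eq_zero_iff] at hc
  rcases hc with hc | hc
  · exact_mod_cast hc
  · exact absurd (by exact_mod_cast hc) (h.pos i).ne'

/-- Along an edge the ratio `a i / d i` of a root changes by at most 2, so a path to `k` bounds
every coordinate. -/
theorem IsNull.finite_roots_zero_at (h : IsNull G d) (hG : G.Preconnected) (k : I) :
    {a | IsRoot G a ∧ a k = 0}.Finite := by
  have hB : ∀ i, ∃ B : ℕ, ∀ a, IsRoot G a → a k = 0 → |(a i : ℝ) / d i| ≤ B := by
    intro i
    obtain ⟨p⟩ := hG i k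
    induction p with
    | nil => exact ⟨0, fun a _ hk => by simp [hk]⟩
    | cons hadj _ ih =>
      obtain ⟨B, hB⟩ := ih
      refine ⟨B + 2, fun a ha hk => ?_⟩
      have h1 := h.sq_sub_le a hadj
      rw [show quad G a = 2 from ha] at h1
      have h2 := abs_le_of_sq_le_sq (b := (2 : ℝ)) (h1.trans (by norm_num)) zero_le_two
      have h3 := abs_le.1 h2
      have h4 := abs_le.1 (hB a ha hk)
      rw [abs_le]
      push_cast
      constructor <;> linarith
  choose B hB using hB
  refine (Set.Finite.pi' fun i => Set.finite_Icc (-(B i * d i : ℤ)) (B i * d i)).subset ?_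
  rintro a ⟨ha, hk⟩ i
  have h1 := hB i a ha hk
  have h2 : (0 : ℝ) < d i := by exact_mod_cast h.pos i
  rw [abs_div, abs_of_pos h2, div_le_iff₀ h2, abs_le] at h1
  exact ⟨by exact_mod_cast h1.1, by exact_mod_cast h1.2⟩

/-- If both signs occurred, the positive and negative parts would be nonzero with a zero coordinate,
hence of norm at least 2 by definiteness and parity. Their cross term is nonpositive, so the root
would have norm at least 4. -/
theorem IsNull.signedRoots (h : IsNull G d) (hG : G.Preconnected) : SignedRoots G := by
  intro a ha
  by_contra! hcon
  obtain ⟨hn, hp⟩ := hcon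
  simp only [Pi.le_def, not_forall, not_le, Pi.zero_apply] at hn hp
  obtain ⟨i, hi⟩ := hn
  obtain ⟨j, hj⟩ := hp
  set b : I → ℤ := fun k => max (a k) 0 with hb
  set c : I → ℤ := fun k => max (-a k) 0 with hc
  have habc : a = b - c := by
    ext k
    simp only [hb, hc, Pi.sub_apply]
    omega
  have hqb : 2 ≤ quad G b := by
    have h0 := h.quad_nonneg b
    obtain ⟨m, hm⟩ := even_quad G b
    have : quad G b ≠ 0 := fun hz => by
      have := congrFun (h.eq_zero_of_quad_eq_zero hG hz (k := i) (by simp [hb, hi.le])) j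
      simp only [hb, Pi.zero_apply] at this
      omega
    omega
  have hqc : 2 ≤ quad G c := by
    have h0 := h.quad_nonneg c
    obtain ⟨m, hm⟩ := even_quad G c
    have : quad G c ≠ 0 := fun hz => by
      have := congrFun (h.eq_zero_of_quad_eq_zero hG hz (k := j) (by simp [hc, hj.le])) i
      simp only [hc, Pi.zero_apply] at this
      omega
    omega
  have hcross : b ⬝ᵥ (cartan G *ᵥ c) ≤ 0 := by
    simp only [dotProduct, mulVec, Finset.mul_sum]
    refine Finset.sum_nonpos fun k _ => Finset.sum_nonpos fun l _ => ?_
    by_cases hkl : k = l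
    · subst hkl
      have : b k = 0 ∨ c k = 0 := by simp only [hb, hc]; omega
      rcases this with h | h <;> simp [h]
    · exact mul_nonpos_of_nonneg_of_nonpos (le_max_right _ _)
        (mul_nonpos_of_nonpos_of_nonneg (cartan_nonpos G hkl) (le_max_right _ _))
  have h2 : quad G a = 2 := ha
  rw [habc, quad_sub] at h2
  omega

theorem IsNull.isRoot_add_smul (h : IsNull G d) {a : I → ℤ} (ha : IsRoot G a) (m : ℤ) :
    IsRoot G (a + m • d) := by
  have h2 : a + m • d = a - (-m) • d := by rw [neg_smul, sub_neg_eq_add]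
  have h3 : cartan G *ᵥ ((-m) • d) = 0 := by rw [mulVec_smul, h.kernel, smul_zero]
  unfold IsRoot at *
  rw [h2, quad_sub, ha, quad, h3, dotProduct_zero, dotProduct_zero]
  norm_num

theorem IsNull.exists_add_smul_nonneg (h : IsNull G d) (a : I → ℤ) :
    ∃ m : ℤ, 0 ≤ a + m • d := by
  refine ⟨∑ i, |a i|, fun i => ?_⟩
  have h1 : |a i| ≤ ∑ i, |a i| :=
    Finset.single_le_sum (f := fun i => |a i|) (fun _ _ => abs_nonneg _) (Finset.mem_univ i)
  have h2 := h.pos i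
  have h3 := neg_abs_le (a i)
  simp only [Pi.zero_apply, Pi.add_apply, Pi.smul_apply, smul_eq_mul]
  nlinarith [abs_nonneg (a i)]

theorem pairing_add_smul (a : I → ℤ) (m : ℤ) {v : I → ℝ} (hv : pairing d v = 0) :
    pairing (a + m • d) v = pairing a v := by
  have : pairing (a + m • d) v = pairing a v + m * pairing d v := by
    unfold pairing
    rw [Finset.mul_sum, ← Finset.sum_add_distrib]
    exact Finset.sum_congr rfl fun i _ => by simp; ring
  rw [this, hv, mul_zero, add_zero]

theorem IsNull.refl_eq (h : IsNull G d) (i : I) : refl G i d = d := by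
  simp [refl, h.kernel]

theorem IsNull.pairing_fire_eq (h : IsNull G d) (i : I) (v : I → ℝ) :
    pairing d (fire G i v) = pairing d v := by
  rw [pairing_fire, h.refl_eq]

theorem pairing_neg_left (a : I → ℤ) (v : I → ℝ) : pairing (-a) v = -pairing a v := by
  simp [pairing]

theorem pairing_neg_right (a : I → ℤ) (v : I → ℝ) :
    pairing a (fun i => -v i) = -pairing a v := by
  simp [pairing]

end Affine

/-! ### Removing a vertex -/

open Classical in
/-- Extension by zero from the complement of a vertex. -/
noncomputable def extendZero (k : I) (b : {j : I // j ≠ k} → ℤ) : I → ℤ :=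
  fun i => if h : i ≠ k then b ⟨i, h⟩ else 0

theorem extendZero_self {I : Type*} (k : I) (b : {j : I // j ≠ k} → ℤ) :
    extendZero k b k = 0 := by
  simp [extendZero]

theorem extendZero_val {I : Type*} (k : I) (b : {j : I // j ≠ k} → ℤ) (j : {j : I // j ≠ k}) :
    extendZero k b j = b j := by
  simp [extendZero, j.2]

theorem extendZero_restrict {I : Type*} (k : I) {a : I → ℤ} (ha : a k = 0) :
    extendZero k (fun j => a j) = a := by
  ext i
  by_cases h : i = k
  · subst h; rw [extendZero_self, ha]
  · exact extendZero_val k (fun j => a j) ⟨i, h⟩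

theorem extendZero_injective {I : Type*} (k : I) :
    Function.Injective (extendZero k : ({j : I // j ≠ k} → ℤ) → I → ℤ) := by
  intro b c h
  ext j
  rw [← extendZero_val k b, h, extendZero_val]

theorem extendZero_nonneg {I : Type*} (k : I) (b : {j : I // j ≠ k} → ℤ) :
    0 ≤ extendZero k b ↔ 0 ≤ b := by
  constructor
  · intro h j
    have := h j
    rwa [extendZero_val] at this
  · intro h i
    by_cases hi : i = k
    · subst hi; rw [extendZero_self]; rfl
    · rw [extendZero_val k b ⟨i, hi⟩]; exact h _

theorem extendZero_neg {I : Type*} (k : I) (b : {j : I // j ≠ k} → ℤ) :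
    extendZero k (-b) = -extendZero k b := by
  ext i
  by_cases h : i = k <;> simp [extendZero, h]

theorem cartan_removeVertex {I : Type*} (G : SimpleGraph I) (k : I) (i j : {j : I // j ≠ k}) :
    cartan (removeVertex G k) i j = cartan G i j := by
  by_cases h : i = j
  · rw [h, cartan_self, cartan_self]
  · have h' : (i : I) ≠ j := fun h' => h (Subtype.ext h')
    by_cases hadj : G.Adj i j <;> simp [cartan, h, h', hadj]

theorem fire_removeVertex {I : Type*} (G : SimpleGraph I) (k : I) (i : {j : I // j ≠ k})
    (v : I → ℝ) :
    (fun j : {j : I // j ≠ k} => fire G i v j) = fire (removeVertex G k) i (fun j => v j) := by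
  ext j
  rw [fire_apply, fire_apply, cartan_removeVertex]

section Remove

variable {I : Type*} [Fintype I] [DecidableEq I] {G : SimpleGraph I} {d : I → ℤ}

theorem quad_extendZero (G : SimpleGraph I) (k : I) (b : {j : I // j ≠ k} → ℤ) :
    quad G (extendZero k b) = quad (removeVertex G k) b := by
  simp only [quad, dotProduct, mulVec]
  rw [Fintype.sum_eq_add_sum_subtype_ne _ k, extendZero_self, zero_mul, zero_add]
  refine Finset.sum_congr rfl fun i _ => ?_
  rw [Fintype.sum_eq_add_sum_subtype_ne _ k, extendZero_self, mul_zero, zero_add, extendZero_val]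
  simp only [extendZero_val, cartan_removeVertex]

theorem isRoot_extendZero (k : I) (b : {j : I // j ≠ k} → ℤ) :
    IsRoot G (extendZero k b) ↔ IsRoot (removeVertex G k) b := by
  unfold IsRoot
  rw [quad_extendZero]

theorem pairing_extendZero (k : I) (b : {j : I // j ≠ k} → ℤ) (v : I → ℝ) :
    pairing (extendZero k b) v = pairing b fun j => v j := by
  unfold pairing
  rw [Fintype.sum_eq_add_sum_subtype_ne _ k, extendZero_self, Int.cast_zero, zero_mul, zero_add]
  simp only [extendZero_val]

theorem SignedRoots.removeVertex (h : SignedRoots G) (k : I) :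
    SignedRoots (removeVertex G k) := by
  intro b hb
  rcases h _ ((isRoot_extendZero k b).2 hb) with h | h
  · exact Or.inl ((extendZero_nonneg k b).1 h)
  · right
    rw [← neg_nonneg, ← extendZero_neg, extendZero_nonneg] at h
    exact neg_nonneg.1 h

theorem IsNull.finite_removeVertex (h : IsNull G d) (hG : G.Preconnected) (k : I) :
    {b | IsRoot (removeVertex G k) b ∧ 0 ≤ b}.Finite := by
  refine Set.Finite.of_finite_image ((h.finite_roots_zero_at hG k).subset ?_)
    (extendZero_injective k).injOn
  rintro _ ⟨b, ⟨hb, -⟩, rfl⟩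
  exact ⟨(isRoot_extendZero k b).2 hb, extendZero_self k b⟩

/-- A vector orthogonal to `d` is bounded on the positive roots if and only if both restrictions
to the complement of an extending vertex are winning. -/
theorem IsNull.bounded_iff_winning (h : IsNull G d) (hG : G.Preconnected) {k : I} (hk : d k = 1)
    {v : I → ℝ} (hv : pairing d v = 0) :
    Bounded G v ↔ Winning (NumbersGame.removeVertex G k) (fun j => v j) ∧
      Winning (NumbersGame.removeVertex G k) (fun j => -v j) := by
  have hs := (h.signedRoots hG).removeVertex k
  have hf := h.finite_removeVertex hG k
  rw [winning_iff_bounded hs hf, winning_iff_bounded hs hf]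
  constructor
  · refine fun hb => ⟨fun b hr h0 => ?_, fun b hr h0 => ?_⟩
    · rw [← pairing_extendZero]
      exact hb _ ((isRoot_extendZero k b).2 hr) ((extendZero_nonneg k b).2 h0)
    · have hr' : IsRoot G (-extendZero k b) :=
        (quad_neg G _).trans ((isRoot_extendZero k b).2 hr)
      -- A translate of the negative root is positive and has the same value on `v`; this bounds `v`
      -- from above on `b`.
      obtain ⟨m, hm⟩ := h.exists_add_smul_nonneg (-extendZero k b)
      have := hb _ (h.isRoot_add_smul hr' m) hm
      rwa [pairing_add_smul _ _ hv, pairing_neg_left, pairing_extendZero,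
        ← pairing_neg_right] at this
  · rintro ⟨h1, h2⟩ a ha h0
    -- As `d k = 1`, this translate vanishes at `k`, so it is a root of the smaller graph, of either
    -- sign.
    have ha' := h.isRoot_add_smul ha (-a k)
    have hz : (a + (-a k) • d) k = 0 := by simp [hk]
    rw [← pairing_add_smul a (-a k) hv]
    generalize a + (-a k) • d = b at ha' hz
    have hb := extendZero_restrict k hz
    rw [← hb, isRoot_extendZero] at ha'
    rw [← hb, pairing_extendZero]
    rcases hs _ ha' with h3 | h3
    · exact h1 _ ha' h3
    · have h4 := h2 _ ((quad_neg _ _).trans ha') (neg_nonneg.2 h3)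
      rwa [pairing_neg_left, pairing_neg_right, neg_neg] at h4

end Remove

/-! ### Orbits of vectors orthogonal to the null vector -/

section Orbit

variable {I : Type*} [Fintype I] {G : SimpleGraph I} {d : I → ℤ}

/-- The values of a configuration on the roots. -/
def rootValues (G : SimpleGraph I) (v : I → ℝ) : Set ℝ := (fun a => pairing a v) '' {a | IsRoot G a}

theorem rootValues_fire (i : I) (v : I → ℝ) : rootValues G (fire G i v) = rootValues G v := by
  ext x
  constructor
  · rintro ⟨a, ha, rfl⟩
    exact ⟨refl G i a, IsRoot.refl ha i, (pairing_fire G i a v).symm⟩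
  · rintro ⟨a, ha, rfl⟩
    exact ⟨refl G i a, IsRoot.refl ha i, pairing_refl_fire G i a v⟩

theorem apply_mem_rootValues (v : I → ℝ) (i : I) : v i ∈ rootValues G v := by
  classical
  exact ⟨Pi.single i 1, isRoot_single G i, pairing_single i v⟩

theorem Reaches.rootValues_eq {v w : I → ℝ} (h : Reaches G v w) :
    rootValues G w = rootValues G v := by
  induction h with
  | refl => rfl
  | tail _ hm ih =>
    obtain ⟨-, i, -, rfl⟩ := hm
    rw [rootValues_fire, ih]

theorem IsNull.finite_rootValues (h : IsNull G d) (hG : G.Preconnected) {k : I} (hk : d k = 1)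
    {v : I → ℝ} (hv : pairing d v = 0) : (rootValues G v).Finite := by
  refine ((h.finite_roots_zero_at hG k).image fun a => pairing a v).subset ?_
  rintro _ ⟨a, ha, rfl⟩
  exact ⟨a + (-a k) • d, ⟨h.isRoot_add_smul ha _, by simp [hk]⟩, pairing_add_smul _ _ hv⟩

/-- Amplitudes are values on simple roots, and the finite set of root values is invariant under
firing. -/
theorem IsNull.finite_reaches (h : IsNull G d) (hG : G.Preconnected) {k : I} (hk : d k = 1)
    {v : I → ℝ} (hv : pairing d v = 0) : {w | Reaches G v w}.Finite := by
  refine (Set.Finite.pi' fun _ : I => h.finite_rootValues hG hk hv).subset fun w hw i => ?_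
  rw [← Reaches.rootValues_eq hw]
  exact apply_mem_rootValues w i

theorem IsNull.eq_zero_of_nonneg (h : IsNull G d) {v : I → ℝ} (hv : pairing d v = 0)
    (h0 : ∀ i, 0 ≤ v i) : v = 0 := by
  have hd : ∀ i, (0 : ℝ) < d i := fun i => by exact_mod_cast h.pos i
  ext i
  have := (Finset.sum_eq_zero_iff_of_nonneg fun i _ => mul_nonneg (hd i).le (h0 i)).1 hv i
    (Finset.mem_univ i)
  exact (mul_eq_zero.1 this).resolve_left (hd i).ne'

theorem IsNull.cannotTerminate (h : IsNull G d) (hs : SignedRoots G) {v : I → ℝ}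
    (hv : pairing d v = 0) (h0 : v ≠ 0) (hb : Bounded G v) : CannotTerminate G v := by
  intro w hw
  have hinv : pairing d w = 0 ∧ w ≠ 0 ∧ Bounded G w := by
    induction hw with
    | refl => exact ⟨hv, h0, hb⟩
    | tail _ hm ih =>
      obtain ⟨-, i, hi, rfl⟩ := hm
      exact ⟨(h.pairing_fire_eq i _).trans ih.1, fire_ne_zero hi, ih.2.2.fire hs hi⟩
  rintro (ht | ht)
  · exact hinv.2.1 (h.eq_zero_of_nonneg hinv.1 ht)
  · exact hinv.2.2.not_forbidden ht

theorem CannotTerminate.exists_play {I : Type*} {G : SimpleGraph I} {v : I → ℝ}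
    (h : CannotTerminate G v) : ∃ u : ℕ → I → ℝ, u 0 = v ∧ ∀ n, Move G (u n) (u (n + 1)) := by
  have hstep : ∀ w : {w // Reaches G v w}, ∃ x : {w // Reaches G v w}, Move G w x := by
    rintro ⟨w, hw⟩
    have ht := h w hw
    simp only [Terminated, not_or, not_forall, not_le] at ht
    obtain ⟨⟨i, hi⟩, hnf⟩ := ht
    have hm : Move G w (fire G i w) := ⟨hnf, i, hi, rfl⟩
    exact ⟨⟨_, hw.tail hm⟩, hm⟩
  choose f hf using hstep
  have hv : Reaches G v v := .refl
  refine ⟨fun n => (f^[n] ⟨v, hv⟩).1, rfl, fun n => ?_⟩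
  simp only [Function.iterate_succ_apply']
  exact hf _

/-- In an infinite sequence of moves, every vertex is fired. -/
theorem IsNull.exists_fire_eq (h : IsNull G d) (hG : G.Preconnected) {u : ℕ → I → ℝ} {s : ℕ → I}
    (hs : ∀ n, u n (s n) < 0) (hu : ∀ n, u (n + 1) = fire G (s n) (u n)) (k : I) :
    ∃ n, s n = k := by
  classical
  by_contra! hk
  -- If `k` is never fired, the play restricts to an infinite play without cutoff on the smaller
  -- graph, where the count of negative roots would decrease forever.
  have hdesc : ∀ n, (negRoots (removeVertex G k) (fun j => u (n + 1) j)).ncard <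
      (negRoots (removeVertex G k) (fun j => u n j)).ncard := fun n => by
    rw [hu, fire_removeVertex G k ⟨s n, hk n⟩]
    exact ncard_negRoots_fire_lt ((h.signedRoots hG).removeVertex k)
      (h.finite_removeVertex hG k) (hs n)
  exact not_strictAnti_of_wellFoundedLT
    (fun n => (negRoots (removeVertex G k) (fun j => u n j)).ncard)
    (strictAnti_nat_of_succ_lt hdesc)

/-- A configuration orthogonal to the null vector from which the game can go on forever is bounded
on the positive roots: otherwise, the heights of the images of a root on which the configuration
is minimal decrease until they stabilize, and from then on some vertex is not fired. -/
theorem IsNull.bounded_of_play (h : IsNull G d) (hG : G.Preconnected) {k : I} (hk : d k = 1)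
    {u : ℕ → I → ℝ} (hv : pairing d (u 0) = 0) (hm : ∀ n, Move G (u n) (u (n + 1))) :
    Bounded G (u 0) := by
  classical
  by_contra hb
  simp only [Bounded, not_forall, not_le] at hb
  obtain ⟨a₁, ha₁, -, hlt⟩ := hb
  obtain ⟨_, ⟨a₂, ha₂, rfl⟩, hmin⟩ := Set.exists_min_image (rootValues G (u 0)) id
    (h.finite_rootValues hG hk hv) ⟨_, a₁, ha₁, rfl⟩
  have hc : pairing a₂ (u 0) < -1 := (hmin _ ⟨a₁, ha₁, rfl⟩).trans_lt hlt
  obtain ⟨m, hm0⟩ := h.exists_add_smul_nonneg a₂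
  set c := pairing a₂ (u 0)
  simp only [id] at hmin
  have hs := h.signedRoots hG
  choose hnf s hneg hfire using hm
  -- `b n` follows a positive translate of the minimizing root through the moves; its value on `u n`
  -- remains `c`.
  let b : ℕ → I → ℤ := fun n => Nat.rec (a₂ + m • d) (fun n a => refl G (s n) a) n
  have hb_succ : ∀ n, b (n + 1) = refl G (s n) (b n) := fun n => rfl
  have hval : ∀ n, rootValues G (u n) = rootValues G (u 0) := fun n => by
    induction n with
    | zero => rfl
    | succ n ih => rw [hfire, rootValues_fire, ih]
  have hroot : ∀ n, IsRoot G (b n) := fun n => by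
    induction n with
    | zero => exact h.isRoot_add_smul ha₂ m
    | succ n ih => exact ih.refl _
  have hpair : ∀ n, pairing (b n) (u n) = c := fun n => by
    induction n with
    | zero => exact pairing_add_smul _ _ hv
    | succ n ih => rw [hfire, hb_succ, pairing_refl_fire, ih]
  -- Positivity could be lost only from the simple root of `s n`, but then the fired amplitude would
  -- be `c < -1`, which is forbidden.
  have hpos : ∀ n, 0 ≤ b n := fun n => by
    induction n with
    | zero => exact hm0
    | succ n ih =>
      rcases (hroot n).eq_single_or_refl_nonneg hs ih (s n) with h1 | h1
      · exfalso
        have h2 := hpair n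
        rw [h1, pairing_single] at h2
        exact hnf n ⟨s n, h2 ▸ hc⟩
      · exact h1
  -- Otherwise the reflected root would take a value below the minimum `c` on `u n`.
  have hr : ∀ n, 0 ≤ (cartan G *ᵥ b n) (s n) := fun n => by
    have h1 : c ≤ pairing (refl G (s n) (b n)) (u n) :=
      hmin _ (hval n ▸ ⟨_, (hroot n).refl _, rfl⟩)
    rw [pairing_refl, hpair] at h1
    have h2 := hneg n
    by_contra! h3
    have h4 : (((cartan G *ᵥ b n) (s n) : ℤ) : ℝ) < 0 := by exact_mod_cast h3
    nlinarith [mul_pos_of_neg_of_neg h4 h2]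
  have hheight : ∀ n, ∑ i, b (n + 1) i = ∑ i, b n i - (cartan G *ᵥ b n) (s n) := fun n => by
    rw [hb_succ]
    simp [refl]
  have hanti : Antitone fun n => ∑ i, b n i :=
    antitone_nat_of_succ_le fun n => by rw [hheight]; linarith [hr n]
  obtain ⟨N, hN⟩ : ∃ N, ∀ n, ∑ i, b N i ≤ ∑ i, b n i := by
    obtain ⟨N, hN⟩ := WellFounded.has_min (measure fun n => (∑ i, b n i).toNat).wf Set.univ
      ⟨0, trivial⟩
    refine ⟨N, fun n => ?_⟩
    have h1 := hN.2 n trivial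
    have h2 : 0 ≤ ∑ i, b n i := Finset.sum_nonneg fun i _ => hpos n i
    have h3 : 0 ≤ ∑ i, b N i := Finset.sum_nonneg fun i _ => hpos N i
    change ¬ ((∑ i, b n i).toNat < (∑ i, b N i).toNat) at h1
    omega
  have hzero : ∀ n, (cartan G *ᵥ b (N + n)) (s (N + n)) = 0 := fun n => by
    have h1 := hheight (N + n)
    have h2 := hN (N + n + 1)
    have h3 : ∑ i, b (N + n) i ≤ ∑ i, b N i := hanti (Nat.le_add_right N n)
    have h4 := hr (N + n)
    omega
  have hconst : ∀ n, b (N + n) = b N := fun n => by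
    induction n with
    | zero => rfl
    | succ n ih =>
      rw [← Nat.add_assoc, hb_succ, refl, hzero, Pi.single_zero, sub_zero, ih]
  -- Every vertex is fired after time `N`, so the now constant root lies in the kernel and has norm
  -- 0 instead of 2.
  have hquad : quad G (b N) = 0 := by
    have hker : cartan G *ᵥ b N = 0 := by
      ext j
      obtain ⟨n, hn⟩ := h.exists_fire_eq hG (u := fun n => u (N + n)) (s := fun n => s (N + n))
        (fun n => hneg _) (fun n => hfire _) j
      have := hzero n
      rwa [hconst, hn] at this
    rw [quad, hker, dotProduct_zero]
  have := hroot N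
  rw [IsRoot, hquad] at this
  norm_num at this

end Orbit

/-! ### Extended Dynkin graphs are connected -/

theorem preconnected_of_descent {V : Type*} {G : SimpleGraph V} (r : V) (f : V → ℕ)
    (h : ∀ x, x ≠ r → ∃ y, G.Adj x y ∧ f y < f x) : G.Preconnected := by
  have key : ∀ n x, f x = n → G.Reachable x r := fun n => by
    induction n using Nat.strong_induction_on with
    | _ n ih =>
      intro x hx
      by_cases hr : x = r
      · rw [hr]
      · obtain ⟨y, hxy, hlt⟩ := h x hr
        exact hxy.reachable.trans (ih _ (hx ▸ hlt) y rfl)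
  exact fun x y => (key _ x rfl).trans (key _ y rfl).symm

namespace SimplyLacedType

theorem extGraphD_preconnected {n : ℕ} (hn : 4 ≤ n) : (extGraphD n).Preconnected := by
  -- The branch vertex 2 gets rank 0 so that the leaves 0 and 1 can descend to it; `n` descends to
  -- `n - 2`, and every other vertex to its predecessor.
  refine preconnected_of_descent ⟨2, by omega⟩ (fun x => if x.val = 2 then 0 else x.val + 1) ?_
  intro x hne
  have hx := x.isLt
  have h2 : x.val ≠ 2 := fun h => hne (Fin.ext h)
  simp only [extGraphD, SimpleGraph.fromRel_adj, ne_eq, Fin.ext_iff]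
  obtain ⟨y, hy⟩ : ∃ y : Fin (n + 1),
      y.val = if x.val < 2 then 2 else if x.val = n then n - 2 else x.val - 1 :=
    ⟨⟨if x.val < 2 then 2 else if x.val = n then n - 2 else x.val - 1, by split_ifs <;> omega⟩, rfl⟩
  refine ⟨y, ?_, ?_⟩ <;> split_ifs at hy ⊢ <;> omega

theorem extGraphE6_preconnected : extGraphE6.Preconnected := by
  refine preconnected_of_descent 0 Fin.val ?_
  simp only [extGraphE6, SimpleGraph.fromRel_adj]
  decide

theorem extGraphE7_preconnected : extGraphE7.Preconnected := by
  refine preconnected_of_descent 0 Fin.val ?_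
  simp only [extGraphE7, SimpleGraph.fromRel_adj]
  decide

theorem extGraphE8_preconnected : extGraphE8.Preconnected := by
  refine preconnected_of_descent 0 Fin.val ?_
  simp only [extGraphE8, SimpleGraph.fromRel_adj]
  decide

theorem extDynkinGraph_preconnected : ∀ X : SimplyLacedType, X.extDynkinGraph.Preconnected
  | A _ _ => SimpleGraph.cycleGraph_preconnected
  | D _ hn => extGraphD_preconnected hn
  | E6 => extGraphE6_preconnected
  | E7 => extGraphE7_preconnected
  | E8 => extGraphE8_preconnected

end SimplyLacedType

theorem IsExtendedDynkin.preconnected {I : Type*} {X : SimplyLacedType} {G : SimpleGraph I}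
    (h : IsExtendedDynkin X G) : G.Preconnected := by
  obtain ⟨e⟩ := h
  exact e.preconnected_iff.2 X.extDynkinGraph_preconnected

end NumbersGame

theorem corollary3p3 {I : Type*} [Fintype I] (X : NumbersGame.SimplyLacedType)
    (G : SimpleGraph I) (hG : NumbersGame.IsExtendedDynkin X G)
    (i₀ : I) (hi₀ : NumbersGame.IsExtendingVertex X G i₀)
    (δ : I → ℤ) (hδ : NumbersGame.IsDelta G i₀ δ)
    (v : I → ℝ) (hv : v ≠ 0) (hδv : ∑ i, (δ i : ℝ) * v i = 0) :
    (NumbersGame.Looping G v ↔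
      NumbersGame.Winning (NumbersGame.removeVertex G i₀) (fun j => v j) ∧
        NumbersGame.Winning (NumbersGame.removeVertex G i₀) (fun j => -v j)) ∧
    (NumbersGame.Looping G v → NumbersGame.CannotTerminate G v) := by
  classical
  have hd := hδ.isNull
  have hG' := hG.preconnected
  have hs := hd.signedRoots hG'
  have hct : NumbersGame.Bounded G v → NumbersGame.CannotTerminate G v :=
    hd.cannotTerminate hs hδv hv
  have hloop : NumbersGame.Looping G v ↔ NumbersGame.Bounded G v := by
    constructor
    · rintro ⟨⟨u, rfl, hu⟩, -⟩
      exact hd.bounded_of_play hG' hδ.extending hδv hu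
    · exact fun hb => ⟨(hct hb).exists_play, hd.finite_reaches hG' hδ.extending hδv⟩
  exact ⟨hloop.trans (hd.bounded_iff_winning hG' hδ.extending hδv), fun hl => hct (hloop.1 hl)⟩
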